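/- Consider a two-player Borel game $(A, u^1, u^2)$: $A$ is an arbitrary nonempty set of actions and $u^1, u^2 : A^{\mathbb{N}} \to \mathbb{R}$ are the payoff functions of the two players. At stages $t = 1, 2, 3, \dots$ an action $a_t \in A$ is chosen, by player 1 if $t$ is odd and by player 2 if $t$ is even, with knowledge of all previous actions; player $i$ then receives $u^i(a_1, a_2, \dots)$. A (pure) strategy of player 1 (of player 2) is a function that assigns an action to every finite sequence of actions of even (of odd) length. For a finite history $h$ and strategies $\sigma^1, \sigma^2$, let $p(\sigma^1, \sigma^2 \mid h) \in A^{\mathbb{N}}$ be the play that starts with $h$ and in which every later action is the one prescribed by $\sigma^1$ or $\sigma^2$, and write $u^i(\sigma^1, \sigma^2 \mid h) = u^i(p(\sigma^1, \sigma^2 \mid h))$. A pair $(\sigma^1_*, \sigma^2_*)$ is a subgame-perfect $\varepsilon$-equilibrium if for every finite history $h$ $$u^1(\sigma^1_*, \sigma^2_* \mid h) \ge u^1(\sigma^1, \sigma^2_* \mid h) - \varepsilon \quad \text{for every strategy } \sigma^1 \text{ of player 1},$$ $$u^2(\sigma^1_*, \sigma^2_* \mid h) \ge u^2(\sigma^1_*,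 \sigma^2 \mid h) - \varepsilon \quad \text{for every strategy } \sigma^2 \text{ of player 2}.$$ Endow $A$ with the discrete topology and $A^{\mathbb{N}}$ with the product topology. **Theorem 9.** If $u^1$ and $u^2$ are bounded and lower-semi-continuous on $A^{\mathbb{N}}$, then for every $\varepsilon > 0$ the game admits a subgame-perfect $\varepsilon$-equilibrium (in pure strategies). -/

import Mathlib

/-- A two-player game of perfect information with alternating moves and common action set `A`:
the two payoffs are functions of the infinite play. The stages are indexed by `0, 1, 2, …`, so
player 1 moves at the stages with even index and player 2 at those with odd index. -/
structure BorelGame (A : Type*) where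
  /-- the payoff of player 1 -/
  u₁ : (ℕ → A) → ℝ
  /-- the payoff of player 2 -/
  u₂ : (ℕ → A) → ℝ

namespace BorelGame

/-- A (pure) strategy of player 1: an action for every finite history of even length. -/
abbrev Strategy₁ (A : Type*) : Type _ := {h : List A // Even h.length} → A

/-- A (pure) strategy of player 2: an action for every finite history of odd length. -/
abbrev Strategy₂ (A : Type*) : Type _ := {h : List A // Odd h.length} → A

/-- The action prescribed after the finite history `h` by the strategy of the player to move. -/
def next {A : Type*} (σ₁ : Strategy₁ A) (σ₂ : Strategy₂ A) (h : List A) : A :=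
  if he : Even h.length then σ₁ ⟨h, he⟩ else σ₂ ⟨h, Nat.not_even_iff_odd.1 he⟩

/-- The infinite play determined by the finite history `h` and a pair of strategies: it starts
with `h`, and each later action is the one prescribed after all the previous ones. -/
def play {A : Type*} (σ₁ : Strategy₁ A) (σ₂ : Strategy₂ A) (h : List A) (n : ℕ) : A :=
  if hn : n < h.length then h[n]
  else next σ₁ σ₂ (List.ofFn fun j : Fin n => play σ₁ σ₂ h j)
termination_by n
decreasing_by exact j.isLt

/-- The pair `(σ₁, σ₂)` is a subgame-perfect `ε`-equilibrium: after every finite history, no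
player gains more than `ε` by changing to any other strategy. -/
def IsSubgamePerfectEquilibrium {A : Type*} (G : BorelGame A) (ε : ℝ)
    (σ₁ : Strategy₁ A) (σ₂ : Strategy₂ A) : Prop :=
  ∀ h : List A,
    (∀ τ₁ : Strategy₁ A, G.u₁ (play σ₁ σ₂ h) ≥ G.u₁ (play τ₁ σ₂ h) - ε) ∧
    (∀ τ₂ : Strategy₂ A, G.u₂ (play σ₁ σ₂ h) ≥ G.u₂ (play σ₁ τ₂ h) - ε)

end BorelGame

/-!
The payoffs are rounded up to multiples of `ε`. This leaves finitely many payoff levels, and the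
rounded payoffs are still lower semicontinuous, so that it suffices to find an exact
subgame-perfect equilibrium for them.

*Elimination.* Assign to every history the set of outcomes (pairs of levels, encoded as functions
on `Bool`, with `true` for player 1 and `false` for player 2) of all its continuations, and repeat
transfinitely: keep an outcome only if it is attained by a continuation such that, wherever the
player to move may deviate, some outcome kept so far after the deviation is no better for him
(`surviving`). When the elimination stops, every persistent outcome comes with a plan all of whose
deviations are deterred by persistent outcomes. Following the plans, and replacing a plan after
each deviation by one that deters it (`exists_plans`), is an equilibrium: along a play in which
only player `i` deviates, the current plans get no better for `i`, and by lower semicontinuity the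
limit play is no better for `i` than the plans after long enough initial histories, which agree
with it on longer and longer stretches.

*Nothing runs empty.* The point is that some outcome survives every round
(`surviving_nonempty`). For the induction on the round `θ` the claim is generalized to games with
terminal histories, each carrying a set `S x` of outcomes. Call a history dead if nothing survives
the round `θ` after it, while the rounds before `θ` left a nonempty set `E x` of outcomes. If `a`
is the action at `x` for which the worst outcome of `E (x ++ [a])` is the best for the player to
move, then all of `E (x ++ [a])` resists deviations at `x`; hence `x ++ [a]` is dead if `x` is.
Choose a dead `h` at which the worst outcome in `E h` for player 1 is the best; then no outcome of
`E h` can be destroyed by player 1 at a dead history. Now make all histories that are not dead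
terminal, and let `b` bound what player 2 gets from the outcomes that survive up to a suitable
round before `θ` after `h`. An outcome that gives him exactly `b` would survive the round `θ` at
the dead history `h`; thus the bound drops to some `b' < b`. By making terminal the dead histories
at which player 2 could deviate from an outcome worth `b'` to him, with outcomes that resist and
are worth more to him, the situation is restored with `b'` in the place of `b`
(`DescentInvariant`). As the induction hypothesis always leaves some surviving outcome after `h`,
the descent never ends, although there are finitely many levels.
-/

/-! ### Histories and attainable outcomes -/

namespace BorelGame

section Elementary

variable {A ι : Type*}

/-- The history consisting of the first `n` actions of the play `p`. -/
def initial (p : ℕ → A) (n : ℕ) : List A := List.ofFn fun j : Fin n => p j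

@[simp]
lemma length_initial (p : ℕ → A) (n : ℕ) : (initial p n).length = n := by
  simp [initial]

lemma initial_succ (p : ℕ → A) (n : ℕ) : initial p (n + 1) = initial p n ++ [p n] := by
  simp only [initial, List.ofFn_succ', List.concat_eq_append]
  rfl

lemma initial_congr {p q : ℕ → A} {n : ℕ} (h : ∀ m < n, p m = q m) :
    initial p n = initial q n := by
  simp only [initial]
  congr 1
  funext j
  exact h j j.isLt

lemma eq_of_initial_eq {p q : ℕ → A} {n m : ℕ} (h : initial p n = initial q n) (hm : m < n) :
    p m = q m :=
  congrFun (List.ofFn_injective h) ⟨m, hm⟩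

/-- `Attainable v S C x r` says that the outcome `r` is attained by some continuation of the
history `x`. The set `S y` collects the outcomes that may be collected by stopping at the history
`y`; a history `y` with `S y = ∅` is not terminal, and passing through it with the outcome `r` in
view requires `C y r`. A continuation either stops at a terminal history or goes on for ever, as a
play `p` with the outcome `v p`. -/
inductive Attainable (v : (ℕ → A) → Bool → ι) (S : List A → Set (Bool → ι))
    (C : List A → (Bool → ι) → Prop) : List A → (Bool → ι) → Prop
  | terminal {x r} (h : r ∈ S x) : Attainable v S C x r
  | forever {x} (p : ℕ → A) (hp : initial p x.length = x)
      (h : ∀ n, x.length ≤ n → S (initial p n) = ∅ ∧ C (initial p n) (v p)) :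
      Attainable v S C x (v p)
  | step {x r} (a : A) (hx : S x = ∅) (hC : C x r) (h : Attainable v S C (x ++ [a]) r) :
      Attainable v S C x r

/-- Attainability without any constraint on the histories on the way is always possible. -/
lemma exists_attainable_of_forall [Nonempty A] (v : (ℕ → A) → Bool → ι)
    (S : List A → Set (Bool → ι)) {C : List A → (Bool → ι) → Prop} (hC : ∀ x r, C x r)
    (x : List A) : ∃ r, Attainable v S C x r := by
  -- If no terminal history can be reached, any infinite continuation will do.
  by_contra hx
  obtain ⟨a⟩ := ‹Nonempty A›
  let p : ℕ → A := fun n => if h : n < x.length then x[n] else a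
  have hp : initial p x.length = x := by
    apply List.ext_getElem (by simp)
    intro n h₁ h₂
    simp [initial, p]
  have hdead : ∀ k, ¬ ∃ r, Attainable v S C (initial p (x.length + k)) r := by
    intro k
    induction k with
    | zero => simpa [hp] using hx
    | succ k ih =>
      rintro ⟨r, hr⟩
      have hS : S (initial p (x.length + k)) = ∅ :=
        Set.eq_empty_iff_forall_notMem.2 fun r' hr' => ih ⟨r', .terminal hr'⟩
      rw [← add_assoc, initial_succ] at hr
      exact ih ⟨r, .step _ hS (hC _ _) hr⟩
  refine hx ⟨v p, .forever p hp fun n hn => ⟨?_, hC _ _⟩⟩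
  obtain ⟨k, rfl⟩ := Nat.exists_eq_add_of_le hn
  exact Set.eq_empty_iff_forall_notMem.2 fun r' hr' => hdead k ⟨r', .terminal hr'⟩

/-- A change of the terminal outcomes and of the constraints that preserves attainability. -/
lemma Attainable.imp {v : (ℕ → A) → Bool → ι} {S S' : List A → Set (Bool → ι)}
    {C C' : List A → (Bool → ι) → Prop} {x : List A} {r : Bool → ι}
    (h : Attainable v S' C' x r)
    (hterminal : ∀ y, r ∈ S' y → Attainable v S C y r)
    (hS : ∀ y, S' y = ∅ → S y = ∅) (hC : ∀ y, S' y = ∅ → C' y r → C y r) :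
    Attainable v S C x r := by
  induction h with
  | terminal h => exact hterminal _ h
  | forever p hp h =>
    exact .forever p hp fun n hn => ⟨hS _ (h n hn).1, hC _ (h n hn).1 (h n hn).2⟩
  | step a hx hC' _ ih => exact .step a (hS _ hx) (hC _ hx hC') (ih hterminal hC)

end Elementary

/-! ### Transfinite elimination of outcomes -/

universe u

variable {ι : Type*} [LinearOrder ι]

/-- The outcomes that survive `ξ` rounds of elimination. A continuation survives if, at every
history `y` on its way, for every earlier round `η` and every action `a`, the player `own y` who
moves at `y` finds an outcome that has survived `η` rounds after `y ++ [a]` and is no better for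
him: otherwise he would rather deviate to `a`. -/
noncomputable def surviving {A : Type u} (v : (ℕ → A) → Bool → ι) (own : List A → Bool)
    (S : List A → Set (Bool → ι)) (ξ : Ordinal.{u}) : List A → Set (Bool → ι) :=
  fun x => {r | Attainable v S (fun y s => ∀ η : Set.Iio ξ, ∀ a,
    ∃ s' ∈ surviving v own S η.1 (y ++ [a]), s' (own y) ≤ s (own y)) x r}
termination_by ξ
decreasing_by exact η.2

/-- The outcome `s` resists, at the history `y`, every deviation judged by `ξ` rounds. -/
def Resists {A : Type u} (v : (ℕ → A) → Bool → ι) (own : List A → Bool)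
    (S : List A → Set (Bool → ι)) (ξ : Ordinal.{u}) (y : List A) (s : Bool → ι) : Prop :=
  ∀ η < ξ, ∀ a, ∃ s' ∈ surviving v own S η (y ++ [a]), s' (own y) ≤ s (own y)

section Elimination

variable {A : Type u} {v : (ℕ → A) → Bool → ι} {own : List A → Bool}
  {S S' : List A → Set (Bool → ι)} {θ : Ordinal.{u}}

lemma mem_surviving {ξ : Ordinal.{u}} {x : List A} {r : Bool → ι} :
    r ∈ surviving v own S ξ x ↔ Attainable v S (Resists v own S ξ) x r := by
  have h : (fun (y : List A) (s : Bool → ι) => ∀ η : Set.Iio ξ, ∀ a,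
      ∃ s' ∈ surviving v own S η.1 (y ++ [a]), s' (own y) ≤ s (own y)) =
      Resists v own S ξ := by
    funext y s
    simp [Resists]
  rw [surviving, Set.mem_ofPred_eq, h]

lemma Resists.mono {ξ : Ordinal.{u}} {y : List A} {s t : Bool → ι}
    (h : Resists v own S ξ y s) (hst : s (own y) ≤ t (own y)) : Resists v own S ξ y t := by
  intro η hη a
  obtain ⟨s', hs', hle⟩ := h η hη a
  exact ⟨s', hs', hle.trans hst⟩

lemma surviving_antitone {η ξ : Ordinal.{u}} (h : η ≤ ξ) (x : List A) :
    surviving v own S ξ x ⊆ surviving v own S η x := by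
  intro r hr
  rw [mem_surviving] at hr ⊢
  exact hr.imp (fun y hy => .terminal hy) (fun y hy => hy)
    fun y _ hC ζ hζ => hC ζ (hζ.trans_le h)

/-- If the terminal outcomes of `S'` survive for `S` in every round before `θ`, and the terminal
histories of `S` are terminal for `S'`, then all that survives for `S'` survives for `S`. -/
lemma surviving_subset (hterminal : ∀ x, ∀ r ∈ S' x, ∀ η < θ, r ∈ surviving v own S η x)
    (hS : ∀ y, S' y = ∅ → S y = ∅) :
    ∀ η < θ, ∀ x, surviving v own S' η x ⊆ surviving v own S η x := by
  intro η
  induction η using WellFoundedLT.induction with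
  | ind η ih =>
    intro hη x r hr
    rw [mem_surviving] at hr ⊢
    refine hr.imp (fun y hy => mem_surviving.1 (hterminal y r hy η hη)) hS fun y _ hC ζ hζ a => ?_
    obtain ⟨s', hs', hle⟩ := hC ζ hζ a
    exact ⟨s', ih ζ hζ (hζ.trans hη) _ hs', hle⟩

variable [Finite ι]

/-- Among nonempty sets of outcomes one has the best minimum for a given player. -/
lemma exists_best_minimum [Nonempty A] (E : A → Set (Bool → ι)) (hE : ∀ a, (E a).Nonempty)
    (i : Bool) : ∃ a₀, ∀ r ∈ E a₀, ∀ a, ∃ r' ∈ E a, r' i ≤ r i := by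
  have hmin : ∀ a, ∃ m ∈ E a, ∀ r ∈ E a, m i ≤ r i := fun a =>
    Set.exists_min_image (E a) (fun r => r i) (Set.toFinite _) (hE a)
  choose m hm hmin using hmin
  obtain ⟨k, ⟨a₀, rfl⟩, hk⟩ := Set.exists_max_image (Set.range fun a => m a i) id
    (Set.toFinite _) (Set.range_nonempty _)
  exact ⟨a₀, fun r hr a => ⟨m a, hm a, (hk _ ⟨a, rfl⟩).trans (hmin a₀ r hr)⟩⟩

/-- Since there are finitely many outcomes, the elimination before the round `θ` stabilizes, at
any given history, in some round before `θ`. -/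
lemma exists_surviving_stable (hθ : 0 < θ) (x : List A) :
    ∃ η < θ, ∀ r ∈ surviving v own S η x, ∀ ζ < θ, r ∈ surviving v own S ζ x := by
  have h : ∀ r : Bool → ι, ∃ η < θ, r ∈ surviving v own S η x →
      ∀ ζ < θ, r ∈ surviving v own S ζ x := by
    intro r
    by_cases hr : ∀ ζ < θ, r ∈ surviving v own S ζ x
    · exact ⟨0, hθ, fun _ => hr⟩
    · push Not at hr
      obtain ⟨ζ, hζ, hr⟩ := hr
      exact ⟨ζ, hζ, fun h => absurd h hr⟩
  choose f hf hstable using h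
  rcases isEmpty_or_nonempty (Bool → ι) with _ | _
  · exact ⟨0, hθ, fun r => isEmptyElim r⟩
  · obtain ⟨r₀, hr₀⟩ := Finite.exists_max f
    exact ⟨f r₀, hf r₀, fun r hr => hstable r (surviving_antitone (hr₀ r) x hr)⟩

end Elimination

/-! ### Some outcome survives every round -/

section Nonempty

variable {A : Type u} {ι : Type*} [LinearOrder ι] {v : (ℕ → A) → Bool → ι}
  {own : List A → Bool} {S : List A → Set (Bool → ι)} {θ : Ordinal.{u}}

/-- The outcomes that survive, after the history `x`, every round before `θ`. -/
def survivingBefore (v : (ℕ → A) → Bool → ι) (own : List A → Bool)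
    (S : List A → Set (Bool → ι)) (θ : Ordinal.{u}) (x : List A) : Set (Bool → ι) :=
  {r | ∀ η < θ, r ∈ surviving v own S η x}

lemma surviving_subset_survivingBefore (x : List A) :
    surviving v own S θ x ⊆ survivingBefore v own S θ x :=
  fun _ hr _ hη => surviving_antitone hη.le x hr

lemma surviving_of_mem {ξ : Ordinal.{u}} {x : List A} {r : Bool → ι} (h : r ∈ S x) :
    r ∈ surviving v own S ξ x :=
  mem_surviving.2 (.terminal h)

lemma resists_of_survivingBefore {y : List A} {s : Bool → ι}
    (h : ∀ a, ∃ s' ∈ survivingBefore v own S θ (y ++ [a]), s' (own y) ≤ s (own y)) :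
    Resists v own S θ y s := by
  intro η hη a
  obtain ⟨s', hs', hle⟩ := h a
  exact ⟨s', hs' η hη, hle⟩

/-- The invariant of the descent that proves `surviving_nonempty`. The terminal outcomes `S'`
replace `S`; a history is dead if nothing survives the round `θ` after it. Where histories are
alive, `S'` consists of the surviving outcomes; terminal dead histories give the player `false`
more than `b`, whereas at the other dead histories an outcome that gives him `b` resists his
deviations; and he gets at most `b` from what survives after `h`. -/
structure DescentInvariant (v : (ℕ → A) → Bool → ι) (own : List A → Bool)
    (S : List A → Set (Bool → ι)) (θ η₀ : Ordinal.{u}) (h : List A) (b : ι)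
    (S' : List A → Set (Bool → ι)) : Prop where
  subset : ∀ x, S' x ⊆ survivingBefore v own S θ x
  alive : ∀ x, (surviving v own S θ x).Nonempty → S' x = surviving v own S θ x
  lt : ∀ x, surviving v own S θ x = ∅ → ∀ r ∈ S' x, b < r false
  resists : ∀ x, surviving v own S θ x = ∅ → S' x = ∅ → own x = false →
    ∀ r : Bool → ι, b ≤ r false → Resists v own S θ x r
  le : ∀ r ∈ surviving v own S' η₀ h, r false ≤ b

namespace DescentInvariant

variable {η₀ : Ordinal.{u}} {h : List A} {b : ι} {S' : List A → Set (Bool → ι)}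

lemma dead (H : DescentInvariant v own S θ η₀ h b S') {x : List A} (hx : S' x = ∅) :
    surviving v own S θ x = ∅ := by
  by_contra hne
  have hne := Set.nonempty_iff_ne_empty.2 hne
  rw [← H.alive x hne, hx] at hne
  simp at hne

lemma eq_empty (H : DescentInvariant v own S θ η₀ h b S') {x : List A} (hx : S' x = ∅) :
    S x = ∅ :=
  Set.eq_empty_iff_forall_notMem.2 fun r hr =>
    Set.eq_empty_iff_forall_notMem.1 (H.dead hx) r (surviving_of_mem hr)

lemma surviving_subset (H : DescentInvariant v own S θ η₀ h b S') :
    ∀ η < θ, ∀ x, surviving v own S' η x ⊆ surviving v own S η x :=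
  BorelGame.surviving_subset (fun x _ hr => H.subset x hr) fun _ => H.eq_empty

/-- A continuation with an outcome that gives exactly `b` to the player `false` meets no terminal
dead history, and he does not deviate from it; the player `true` does not deviate either if his
dead histories resist the outcome. As the continuation does not survive, there is none. -/
lemma lt_of_mem (H : DescentInvariant v own S θ η₀ h b S') (hη₀ : η₀ < θ)
    (hdead : surviving v own S θ h = ∅)
    (htrue : ∀ x, surviving v own S θ x = ∅ → own x = true →
      ∀ r ∈ surviving v own S η₀ h, Resists v own S θ x r)
    {r : Bool → ι} (hr : r ∈ surviving v own S' η₀ h) : r false < b := by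
  refine lt_of_le_of_ne (H.le r hr) fun hb => ?_
  refine Set.eq_empty_iff_forall_notMem.1 hdead r (mem_surviving.2 ?_)
  refine (mem_surviving.1 hr).imp (fun y hy => ?_) (fun _ => H.eq_empty) fun y hy _ => ?_
  · rcases (surviving v own S θ y).eq_empty_or_nonempty with hy' | hy'
    · exact absurd hb (H.lt y hy' r hy).ne'
    · rw [H.alive y hy'] at hy
      exact mem_surviving.1 hy
  · cases hown : own y with
    | true => exact htrue y (H.dead hy) hown r (H.surviving_subset η₀ hη₀ h hr)
    | false => exact H.resists y (H.dead hy) hy hown r hb.ge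

end DescentInvariant

variable [Finite ι]

lemma survivingBefore_nonempty (hθ : 0 < θ)
    (ih : ∀ η < θ, ∀ x, (surviving v own S η x).Nonempty) (x : List A) :
    (survivingBefore v own S θ x).Nonempty := by
  obtain ⟨η, hη, hstable⟩ := exists_surviving_stable (v := v) (own := own) (S := S) hθ x
  obtain ⟨r, hr⟩ := ih η hη x
  exact ⟨r, hstable r hr⟩

variable [Nonempty A]

/-- The player who moves at `x` has an action `a` such that whatever survives after `x ++ [a]`
resists his deviations at `x`: the action whose worst surviving outcome is the best for him. -/
lemma exists_resistant_action (hne : ∀ x, (survivingBefore v own S θ x).Nonempty)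
    (x : List A) :
    ∃ a, ∀ r ∈ survivingBefore v own S θ (x ++ [a]), Resists v own S θ x r := by
  obtain ⟨a, ha⟩ := exists_best_minimum (fun a => survivingBefore v own S θ (x ++ [a]))
    (fun a => hne _) (own x)
  exact ⟨a, fun r hr => resists_of_survivingBefore (ha r hr)⟩

/-- The descent step: at the dead histories where the bound `b'` does not resist the deviations
of the player `false`, the outcomes that do resist become terminal. They give him more than
`b'`. -/
lemma DescentInvariant.exists_of_le {η₀ : Ordinal.{u}} {h : List A} {b : ι}
    {S' : List A → Set (Bool → ι)} (H : DescentInvariant v own S θ η₀ h b S') (hη₀ : η₀ < θ)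
    (ih : ∀ S : List A → Set (Bool → ι), ∀ η < θ, ∀ x, (surviving v own S η x).Nonempty)
    {b' : ι} (hb : b' ≤ b) (hb' : ∀ r ∈ surviving v own S' η₀ h, r false ≤ b') :
    ∃ S'', DescentInvariant v own S θ η₀ h b' S'' := by
  let N : List A → Set (Bool → ι) := fun x => {r | surviving v own S θ x = ∅ ∧ own x = false ∧
    S' x = ∅ ∧ ¬ (∀ t : Bool → ι, b' ≤ t false → Resists v own S θ x t) ∧
    r ∈ survivingBefore v own S' θ x ∧ Resists v own S θ x r}
  have hsub : ∀ η < θ, ∀ x, surviving v own (fun x => S' x ∪ N x) η x ⊆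
      surviving v own S' η x := by
    refine BorelGame.surviving_subset (fun x r hr η hη => ?_) fun x hx => ?_
    · rcases hr with hr | hr
      · exact surviving_of_mem hr
      · exact hr.2.2.2.2.1 η hη
    · exact (Set.union_empty_iff.1 hx).1
  refine ⟨fun x => S' x ∪ N x, ⟨fun x r hr => ?_, fun x hx => ?_, fun x hx r hr => ?_,
    fun x hdead hx hown => ?_, fun r hr => hb' r (hsub η₀ hη₀ h hr)⟩⟩
  · rcases hr with hr | hr
    · exact H.subset x hr
    · exact fun η hη => H.surviving_subset η hη x (hr.2.2.2.2.1 η hη)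
  · have hN : N x = ∅ :=
      Set.eq_empty_iff_forall_notMem.2 fun r hr => hx.ne_empty hr.1
    simp only [hN, Set.union_empty, H.alive x hx]
  · rcases hr with hr | hr
    · exact hb.trans_lt (H.lt x hx r hr)
    · obtain ⟨_, hown, _, hnot, _, hres⟩ := hr
      by_contra hle
      refine hnot fun t ht => hres.mono ?_
      rw [hown]
      exact (not_lt.1 hle).trans ht
  · by_contra hnot
    obtain ⟨hS'x, hNx⟩ := Set.union_empty_iff.1 hx
    have hne := survivingBefore_nonempty (pos_of_gt hη₀) (ih S')
    obtain ⟨a, ha⟩ := exists_resistant_action hne x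
    obtain ⟨r, hr⟩ := hne (x ++ [a])
    refine Set.eq_empty_iff_forall_notMem.1 hNx r ⟨hdead, hown, hS'x, hnot, fun η hη => ?_, ?_⟩
    · refine mem_surviving.2 (.step a hS'x (fun ζ hζ => ha r hr ζ (hζ.trans hη)) ?_)
      exact mem_surviving.1 (hr η hη)
    · intro η hη c
      obtain ⟨s, hs, hle⟩ := ha r hr η hη c
      exact ⟨s, H.surviving_subset η hη _ hs, hle⟩

/-- Some outcome survives, whatever the terminal outcomes and the number of rounds. -/
theorem surviving_nonempty (v : (ℕ → A) → Bool → ι) (own : List A → Bool) (ξ : Ordinal.{u}) :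
    ∀ (S : List A → Set (Bool → ι)) (x : List A), (surviving v own S ξ x).Nonempty := by
  induction ξ using WellFoundedLT.induction with
  | ind θ ih =>
  intro S x
  rcases eq_or_ne θ 0 with rfl | hθ
  · obtain ⟨r, hr⟩ := exists_attainable_of_forall v S (C := Resists v own S 0)
      (fun x r η hη => absurd hη not_lt_zero) x
    exact ⟨r, mem_surviving.2 hr⟩
  have hθ : 0 < θ := pos_iff_ne_zero.2 hθ
  have hne := survivingBefore_nonempty hθ fun η hη => ih η hη S
  by_contra hx
  -- After a dead history, the resistant action leads to a dead history.
  have hchild : ∀ g, surviving v own S θ g = ∅ → ∃ a, surviving v own S θ (g ++ [a]) = ∅ ∧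
      ∀ r ∈ survivingBefore v own S θ (g ++ [a]), Resists v own S θ g r := by
    intro g hg
    obtain ⟨a, ha⟩ := exists_resistant_action hne g
    refine ⟨a, ?_, ha⟩
    by_contra hga
    obtain ⟨r, hr⟩ := Set.nonempty_iff_ne_empty.2 hga
    have hSg : S g = ∅ := Set.eq_empty_iff_forall_notMem.2 fun t ht =>
      Set.eq_empty_iff_forall_notMem.1 hg t (surviving_of_mem ht)
    exact Set.eq_empty_iff_forall_notMem.1 hg r (mem_surviving.2
      (.step a hSg (ha r (surviving_subset_survivingBefore _ hr)) (mem_surviving.1 hr)))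
  -- The dead history `h` has the best worst surviving outcome for the player `true`.
  have hmin : ∀ g, ∃ m ∈ survivingBefore v own S θ g, ∀ r ∈ survivingBefore v own S θ g,
      m true ≤ r true :=
    fun g => Set.exists_min_image _ (fun r : Bool → ι => r true) (Set.toFinite _) (hne g)
  choose m hm hmin using hmin
  obtain ⟨_, ⟨h, hh, rfl⟩, hmax⟩ := Set.exists_max_image
    ((fun g => m g true) '' {g | surviving v own S θ g = ∅}) id (Set.toFinite _)
    ⟨_, x, Set.not_nonempty_iff_eq_empty.1 hx, rfl⟩
  obtain ⟨η₀, hη₀, hstable⟩ := exists_surviving_stable (v := v) (own := own) (S := S) hθ h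
  have htrue : ∀ g, surviving v own S θ g = ∅ → own g = true →
      ∀ r ∈ surviving v own S η₀ h, Resists v own S θ g r := by
    intro g hg hown r hr
    obtain ⟨a, hga, ha⟩ := hchild g hg
    refine (ha (m (g ++ [a])) (hm _)).mono ?_
    rw [hown]
    exact (hmax _ ⟨g ++ [a], hga, rfl⟩).trans (hmin h r (hstable r hr))
  have hdescent : ∀ b, ¬ ∃ S', DescentInvariant v own S θ η₀ h b S' := by
    intro b
    induction b using WellFoundedLT.induction with
    | ind b ihb =>
      rintro ⟨S', H⟩
      obtain ⟨r, hr, hmax⟩ := Set.exists_max_image (surviving v own S' η₀ h)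
        (fun r => r false) (Set.toFinite _) (ih η₀ hη₀ S' h)
      have hlt := H.lt_of_mem hη₀ hh htrue hr
      exact ihb _ hlt (H.exists_of_le hη₀ (fun S η hη => ih η hη S) hlt.le hmax)
  obtain ⟨r, -⟩ := hne h
  have : Nonempty ι := ⟨r true⟩
  obtain ⟨b, hb⟩ := Finite.exists_max (id : ι → ι)
  refine hdescent b ⟨surviving v own S θ, surviving_subset_survivingBefore, fun _ _ => rfl,
    fun g hg r hr => ?_, fun g hg _ hown r hr => ?_, fun r _ => hb _⟩
  · rw [hg] at hr
    exact hr.elim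
  · obtain ⟨a, -, ha⟩ := hchild g hg
    refine (ha (m (g ++ [a])) (hm _)).mono ?_
    rw [hown]
    exact (hb _).trans hr

end Nonempty

/-! ### Plans that deter deviations -/

section Plans

variable {A : Type u} {ι : Type} [LinearOrder ι] {v : (ℕ → A) → Bool → ι}
  {own : List A → Bool}

/-- The outcomes that survive, after the history `x`, every number of rounds. -/
def persistent (v : (ℕ → A) → Bool → ι) (own : List A → Bool) (x : List A) :
    Set (Bool → ι) :=
  {r | ∀ ξ : Ordinal.{u}, r ∈ surviving v own (fun _ => ∅) ξ x}

/-- The play `p` is a plan at the history `x`: it continues `x`, and each deviation from it is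
deterred by a persistent outcome. -/
def IsPlan (v : (ℕ → A) → Bool → ι) (own : List A → Bool) (x : List A) (p : ℕ → A) : Prop :=
  initial p x.length = x ∧ ∀ n, x.length ≤ n → ∀ a,
    ∃ r ∈ persistent v own (initial p n ++ [a]), r (own (initial p n)) ≤ v p (own (initial p n))

lemma eq_and_eq_of_initial_succ {p : ℕ → A} {x : List A} {a : A}
    (h : initial p (x.length + 1) = x ++ [a]) : initial p x.length = x ∧ p x.length = a := by
  rw [initial_succ] at h
  obtain ⟨h₁, h₂⟩ := List.append_inj' h rfl
  exact ⟨h₁, List.singleton_injective h₂⟩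

lemma IsPlan.next {x : List A} {p : ℕ → A} (h : IsPlan v own x p) :
    IsPlan v own (x ++ [p x.length]) p := by
  refine ⟨?_, fun n hn => h.2 n ?_⟩
  · rw [List.length_append, List.length_singleton, initial_succ, h.1]
  · exact (by simp : x.length ≤ (x ++ [p x.length]).length).trans hn

/-- The elimination stops: there are no more histories and outcomes than ordinals. -/
lemma exists_surviving_subset_persistent [Finite ι] (v : (ℕ → A) → Bool → ι) (own : List A → Bool) :
    ∃ ξ : Ordinal.{u}, ∀ x, surviving v own (fun _ => ∅) ξ x ⊆ persistent v own x := by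
  have h : ∀ z : List A × (Bool → ι), ∃ ξ : Ordinal.{u},
      z.2 ∈ surviving v own (fun _ => ∅) ξ z.1 → z.2 ∈ persistent v own z.1 := by
    intro z
    by_cases hz : z.2 ∈ persistent v own z.1
    · exact ⟨0, fun _ => hz⟩
    · obtain ⟨ξ, hξ⟩ := not_forall.1 hz
      exact ⟨ξ, fun h => absurd h hξ⟩
  choose f hf using h
  exact ⟨⨆ z, f z, fun x r hr =>
    hf (x, r) (surviving_antitone (Ordinal.le_iSup f (x, r)) x hr)⟩

variable [Finite ι]

lemma exists_isPlan_of_mem_persistent {x : List A} {r : Bool → ι}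
    (hr : r ∈ persistent v own x) : ∃ p, IsPlan v own x p ∧ v p = r := by
  obtain ⟨ξ, hξ⟩ := exists_surviving_subset_persistent v own
  have key : ∀ y s, Resists v own (fun _ => ∅) (Order.succ ξ) y s → ∀ a,
      ∃ s' ∈ persistent v own (y ++ [a]), s' (own y) ≤ s (own y) := by
    intro y s h a
    obtain ⟨s', hs', hle⟩ := h ξ (Order.lt_succ ξ) a
    exact ⟨s', hξ _ hs', hle⟩
  have h := mem_surviving.1 (hr (Order.succ ξ))
  clear hr
  induction h with
  | terminal h => exact h.elim
  | forever p hp h => exact ⟨p, ⟨hp, fun n hn => key _ _ (h n hn).2⟩, rfl⟩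
  | @step x r a hx hC h ih =>
    obtain ⟨p, ⟨hp, hdet⟩, rfl⟩ := ih
    rw [List.length_append, List.length_singleton] at hp hdet
    obtain ⟨hp, -⟩ := eq_and_eq_of_initial_succ hp
    refine ⟨p, ⟨hp, fun n hn => ?_⟩, rfl⟩
    rcases hn.eq_or_lt with rfl | hn
    · rw [hp]
      exact key _ _ hC
    · exact hdet n hn

lemma exists_isPlan [Nonempty A] (v : (ℕ → A) → Bool → ι) (own : List A → Bool)
    (x : List A) : ∃ p, IsPlan v own x p := by
  obtain ⟨ξ, hξ⟩ := exists_surviving_subset_persistent v own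
  obtain ⟨r, hr⟩ := surviving_nonempty v own ξ (fun _ => ∅) x
  obtain ⟨p, hp, -⟩ := exists_isPlan_of_mem_persistent (hξ x hr)
  exact ⟨p, hp⟩

lemma IsPlan.exists_deviation {x : List A} {p : ℕ → A} (h : IsPlan v own x p) (a : A) :
    ∃ q, IsPlan v own (x ++ [a]) q ∧ v q (own x) ≤ v p (own x) := by
  obtain ⟨r, hr, hle⟩ := h.2 x.length le_rfl a
  rw [h.1] at hr hle
  obtain ⟨q, hq, rfl⟩ := exists_isPlan_of_mem_persistent hr
  exact ⟨q, hq, hle⟩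

/-- An assignment of a plan to every history: the plan is kept as long as it is followed, and a
deviation never leads to a plan that is better for the player who deviates. -/
lemma exists_plans [Nonempty A] (v : (ℕ → A) → Bool → ι) (own : List A → Bool) :
    ∃ π : List A → ℕ → A, (∀ x, initial (π x) x.length = x) ∧
      (∀ x, π (x ++ [π x x.length]) = π x) ∧
      ∀ x a, v (π (x ++ [a])) (own x) ≤ v (π x) (own x) := by
  classical
  have hdev : ∀ x p a, ∃ q, IsPlan v own x p →
      IsPlan v own (x ++ [a]) q ∧ v q (own x) ≤ v p (own x) := by
    intro x p a
    by_cases h : IsPlan v own x p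
    · obtain ⟨q, hq⟩ := h.exists_deviation a
      exact ⟨q, fun _ => hq⟩
    · exact ⟨p, fun h' => absurd h' h⟩
  choose dev hdev using hdev
  obtain ⟨p₀, hp₀⟩ := exists_isPlan v own []
  -- The recursion is on the reversed history, whose head is the latest action.
  let ρ : List A → ℕ → A := fun l => List.rec (motive := fun _ => ℕ → A) p₀
    (fun a l q => if q l.length = a then q else dev l.reverse q a) l
  have hcons : ∀ (a : A) (l : List A),
      ρ (a :: l) = if ρ l l.length = a then ρ l else dev l.reverse (ρ l) a := fun _ _ => rfl
  have hplan : ∀ l, IsPlan v own l.reverse (ρ l) := by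
    intro l
    induction l with
    | nil => exact hp₀
    | cons a l ih =>
      rw [hcons, List.reverse_cons]
      split_ifs with h
      · have := ih.next
        rwa [List.length_reverse, h] at this
      · exact (hdev _ _ a ih).1
  refine ⟨fun x => ρ x.reverse, fun x => ?_, fun x => ?_, fun x a => ?_⟩
  · simpa using (hplan x.reverse).1
  · simp [hcons]
  · have := hplan x.reverse
    rw [List.reverse_reverse] at this
    simp only [List.reverse_append, List.reverse_singleton, List.singleton_append, hcons,
      List.reverse_reverse]
    split_ifs
    · exact le_rfl
    · exact (hdev x _ a this).2

end Plans

/-! ### The equilibrium generated by the plans -/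

section Play

variable {A : Type*}

lemma play_of_lt (σ₁ : Strategy₁ A) (σ₂ : Strategy₂ A) {h : List A} {n : ℕ}
    (hn : n < h.length) : play σ₁ σ₂ h n = h[n] := by
  rw [play, dif_pos hn]

lemma play_of_le (σ₁ : Strategy₁ A) (σ₂ : Strategy₂ A) {h : List A} {n : ℕ}
    (hn : h.length ≤ n) : play σ₁ σ₂ h n = next σ₁ σ₂ (initial (play σ₁ σ₂ h) n) := by
  rw [play, dif_neg hn.not_gt, initial]

lemma initial_play (σ₁ : Strategy₁ A) (σ₂ : Strategy₂ A) (h : List A) :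
    initial (play σ₁ σ₂ h) h.length = h := by
  refine List.ext_getElem (by simp) fun n _ hn => ?_
  simp [initial, play_of_lt σ₁ σ₂ hn]

lemma play_eq {σ₁ : Strategy₁ A} {σ₂ : Strategy₂ A} {h : List A} {p : ℕ → A}
    (hp : initial p h.length = h)
    (hnext : ∀ n, h.length ≤ n → p n = next σ₁ σ₂ (initial p n)) : play σ₁ σ₂ h = p := by
  funext n
  induction n using Nat.strong_induction_on with
  | _ n ih =>
    rcases lt_or_ge n h.length with hn | hn
    · exact eq_of_initial_eq ((initial_play σ₁ σ₂ h).trans hp.symm) hn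
    · rw [play_of_le σ₁ σ₂ hn, hnext n hn, initial_congr ih]

/-- The owner of a history in the alternating game: `true` stands for player 1. -/
def mover (h : List A) : Bool := decide (Even h.length)

/-- The strategies that follow the plans `π` generate the plan of every history. -/
lemma play_plans {π : List A → ℕ → A} (hinit : ∀ x, initial (π x) x.length = x)
    (hkeep : ∀ x, π (x ++ [π x x.length]) = π x) (h : List A) :
    play (fun x => π x.1 x.1.length) (fun x => π x.1 x.1.length) h = π h := by
  have hconst : ∀ n, h.length ≤ n → π (initial (π h) n) = π h := by
    intro n hn
    induction n, hn using Nat.le_induction with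
    | base => rw [hinit]
    | succ n hn ih =>
      have := hkeep (initial (π h) n)
      rwa [length_initial, ih, ← initial_succ] at this
  refine play_eq (hinit h) fun n hn => ?_
  simp [next, hconst n hn]

/-- Along a play `q` in which only the player `i` deviates from the plans, the plans get no
better for `i`. -/
lemma plan_le_of_deviation {ι : Type*} [Preorder ι] {v : (ℕ → A) → Bool → ι}
    {own : List A → Bool} {π : List A → ℕ → A}
    (hkeep : ∀ x, π (x ++ [π x x.length]) = π x)
    (hdev : ∀ x a, v (π (x ++ [a])) (own x) ≤ v (π x) (own x))
    {h : List A} {q : ℕ → A} (hq : initial q h.length = h) {i : Bool}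
    (hfollow : ∀ n, h.length ≤ n → own (initial q n) ≠ i → q n = π (initial q n) n) :
    ∀ n, h.length ≤ n → v (π (initial q n)) i ≤ v (π h) i := by
  intro n hn
  induction n, hn using Nat.le_induction with
  | base => rw [hq]
  | succ n hn ih =>
    refine le_trans ?_ ih
    rw [initial_succ]
    by_cases hi : own (initial q n) = i
    · rw [← hi]
      exact hdev _ _
    · have := hkeep (initial q n)
      rw [length_initial, ← hfollow n hn hi] at this
      rw [this]

/-- A neighbourhood of a play contains all the plays that agree with it long enough. -/
lemma exists_initial_of_mem_nhds [TopologicalSpace A] [DiscreteTopology A] {q : ℕ → A}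
    {s : Set (ℕ → A)} (hs : s ∈ nhds q) : ∃ n, ∀ p, initial p n = initial q n → p ∈ s := by
  rw [nhds_pi, Filter.mem_pi] at hs
  obtain ⟨I, hI, t, ht, hsub⟩ := hs
  obtain ⟨N, hN⟩ := hI.bddAbove
  refine ⟨N + 1, fun p hp => hsub fun i hi => ?_⟩
  rw [eq_of_initial_eq hp (Nat.lt_succ_of_le (hN hi))]
  exact mem_of_mem_nhds (ht i)

/-- A game with finitely many payoff levels, each of them lower semicontinuous, has an exact
subgame-perfect equilibrium. -/
theorem exists_equilibrium_of_finite [Nonempty A] {ι : Type} [LinearOrder ι] [Finite ι]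
    (v : (ℕ → A) → Bool → ι)
    (hv : ∀ q i, ∃ n, ∀ p, initial p n = initial q n → v q i ≤ v p i) :
    ∃ (σ₁ : Strategy₁ A) (σ₂ : Strategy₂ A), ∀ h : List A,
      (∀ τ₁, v (play τ₁ σ₂ h) true ≤ v (play σ₁ σ₂ h) true) ∧
      (∀ τ₂, v (play σ₁ τ₂ h) false ≤ v (play σ₁ σ₂ h) false) := by
  obtain ⟨π, hinit, hkeep, hdev⟩ := exists_plans v mover
  have key : ∀ (h : List A) (q : ℕ → A) (i : Bool), initial q h.length = h →
      (∀ n, h.length ≤ n → mover (initial q n) ≠ i → q n = π (initial q n) n) →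
      v q i ≤ v (π h) i := by
    intro h q i hq hfollow
    obtain ⟨N, hN⟩ := hv q i
    refine (hN (π (initial q (max N h.length))) ?_).trans
      (plan_le_of_deviation hkeep hdev hq hfollow _ (le_max_right _ _))
    have := hinit (initial q (max N h.length))
    rw [length_initial] at this
    exact initial_congr fun m hm => eq_of_initial_eq this (hm.trans_le (le_max_left _ _))
  refine ⟨fun x => π x.1 x.1.length, fun x => π x.1 x.1.length, fun h => ?_⟩
  rw [play_plans hinit hkeep]
  refine ⟨fun τ => key h _ true (initial_play _ _ h) fun n hn hi => ?_,
    fun τ => key h _ false (initial_play _ _ h) fun n hn hi => ?_⟩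
  · have hodd : ¬ Even n := by simpa [mover] using hi
    rw [play_of_le _ _ hn, next, dif_neg (by simpa using hodd)]
    simp
  · have heven : Even n := by simpa [mover] using hi
    rw [play_of_le _ _ hn, next, dif_pos (by simpa using heven)]
    simp

end Play

/-! ### Rounding the payoffs -/

/-- The levels `⌈(u p + M) / ε⌉₊` of a lower semicontinuous payoff are lower semicontinuous. -/
lemma exists_initial_ceil_le {A : Type*} [TopologicalSpace A] [DiscreteTopology A]
    {u : (ℕ → A) → ℝ} (hu : LowerSemicontinuous u) {M ε : ℝ} (hε : 0 < ε) (q : ℕ → A) :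
    ∃ n, ∀ p, initial p n = initial q n → ⌈(u q + M) / ε⌉₊ ≤ ⌈(u p + M) / ε⌉₊ := by
  rcases Nat.eq_zero_or_eq_succ_pred ⌈(u q + M) / ε⌉₊ with h | h
  · exact ⟨0, fun p _ => by simp [h]⟩
  · set k := ⌈(u q + M) / ε⌉₊.pred
    have hk : (k : ℝ) < (u q + M) / ε := Nat.lt_ceil.1 (h ▸ Nat.lt_succ_self k)
    rw [lt_div_iff₀ hε] at hk
    obtain ⟨n, hn⟩ := exists_initial_of_mem_nhds (hu q (k * ε - M) (by linarith))
    refine ⟨n, fun p hp => ?_⟩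
    have hp : k * ε - M < u p := hn p hp
    rw [h, Nat.succ_le_iff, Nat.lt_ceil, lt_div_iff₀ hε]
    linarith

lemma sub_le_of_ceil_le {x y M ε : ℝ} (hε : 0 < ε) (hx : 0 ≤ x + M)
    (h : ⌈(y + M) / ε⌉₊ ≤ ⌈(x + M) / ε⌉₊) : y - ε ≤ x := by
  have h₁ : (y + M) / ε < (x + M) / ε + 1 :=
    (Nat.ceil_le.1 h).trans_lt (Nat.ceil_lt_add_one (by positivity))
  rw [div_add_one hε.ne', div_lt_div_iff_of_pos_right hε] at h₁
  linarith

end BorelGame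

theorem theorem9 {A : Type*} [Nonempty A] [TopologicalSpace A] [DiscreteTopology A]
    (G : BorelGame A)
    (hbdd₁ : ∃ M : ℝ, ∀ p : ℕ → A, |G.u₁ p| ≤ M)
    (hbdd₂ : ∃ M : ℝ, ∀ p : ℕ → A, |G.u₂ p| ≤ M)
    (hlsc₁ : LowerSemicontinuous G.u₁)
    (hlsc₂ : LowerSemicontinuous G.u₂)
    (ε : ℝ) (hε : 0 < ε) :
    ∃ (σ₁ : BorelGame.Strategy₁ A) (σ₂ : BorelGame.Strategy₂ A),
      G.IsSubgamePerfectEquilibrium ε σ₁ σ₂ := by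
  obtain ⟨M₁, hM₁⟩ := hbdd₁
  obtain ⟨M₂, hM₂⟩ := hbdd₂
  let u : (ℕ → A) → Bool → ℝ := fun p i => bif i then G.u₁ p else G.u₂ p
  let M : ℝ := max M₁ M₂
  have hM : ∀ p i, |u p i| ≤ M := by
    rintro p (_ | _)
    · exact (hM₂ p).trans (le_max_right _ _)
    · exact (hM₁ p).trans (le_max_left _ _)
  have hlsc : ∀ i, LowerSemicontinuous fun p => u p i := by
    rintro (_ | _)
    · exact hlsc₂
    · exact hlsc₁
  -- The payoffs are measured in units of `ε`, from `-M` upwards and rounded up.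
  let v : (ℕ → A) → Bool → Fin (⌈(M + M) / ε⌉₊ + 1) := fun p i =>
    ⟨⌈(u p i + M) / ε⌉₊, Nat.lt_succ_of_le (Nat.ceil_mono
      (div_le_div_of_nonneg_right (by linarith [(abs_le.1 (hM p i)).2]) hε.le))⟩
  have hle : ∀ p q i, v q i ≤ v p i → u q i - ε ≤ u p i := fun p q i h =>
    BorelGame.sub_le_of_ceil_le hε (by linarith [(abs_le.1 (hM p i)).1]) h
  obtain ⟨σ₁, σ₂, hσ⟩ := BorelGame.exists_equilibrium_of_finite v
    fun q i => BorelGame.exists_initial_ceil_le (hlsc i) hε q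
  exact ⟨σ₁, σ₂, fun h => ⟨fun τ => hle _ _ true ((hσ h).1 τ),
    fun τ => hle _ _ false ((hσ h).2 τ)⟩⟩
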